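/- For $k,n\in\mathbb N$ let $\mathrm{Dyck}_{k,n}:\{0,1\}^n\to\{0,1\}$ be the function with $\mathrm{Dyck}_{k,n}(x)=1$ if and only if the word obtained from $x$ by reading $0$ as an opening and $1$ as a closing parenthesis is a balanced sequence of parentheses of depth at most $k$, i.e. in every prefix the number of opening minus the number of closing parentheses lies between $0$ and $k$, and in the whole word it is $0$. Let $Q(f)$ be the quantum query complexity of a Boolean function $f$ on $n$ bits: the least number of queries to the oracle $|i\rangle|z\rangle|w\rangle\mapsto|i\rangle|z\oplus x_i\rangle|w\rangle$ made by an algorithm that alternates arbitrary input-independent unitaries with the oracle, measures at the end, and outputs $f(x)$ with probability at least $2/3$ for every input $x$. Then for every $\epsilon>0$ there is $c>0$ such that \[Q\bigl(\mathrm{Dyck}_{\lfloor c\log n\rfloor,\,n}\bigr)=\Omega\bigl(n^{1-\epsilon}\bigr)\] as $n\to\infty$ over the even integers; that is, there are $C>0$ and $N$ such that $Q(\mathrm{Dyck}_{\lfloor c\log n\rfloor,n})\ge C\,n^{1-\epsilon}$ for all even $n\ge N$. -/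

import Mathlib

/-!
Quantum query complexity of (possibly partial) Boolean functions, and the problem of
recognizing Dyck words of bounded depth.
-/

/-- A quantum query algorithm with access to an input of `n` bits. Its state space is
spanned by the basis states `|i⟩|z⟩|w⟩`, where `i : Fin n` is the index register, `z : Bool` is the
register into which the oracle writes, and `w : Fin work` is a work-space of arbitrary finite
dimension. It starts in a basis state, applies the unitary `U 0`, then `queries` times the oracle
followed by the next unitary `U 1, …, U queries`, and finally measures in the
basis; `output` says which bit is returned on each measurement outcome. None of these data depend
on the input. -/
structure QueryAlgorithm (n : ℕ) where
  queries : ℕ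
  work : ℕ
  start : Fin n × Bool × Fin work
  U : ℕ → Matrix.unitaryGroup (Fin n × Bool × Fin work) ℂ
  output : Fin n × Bool × Fin work → Bool

/-- The oracle of the input `x`: the unitary `|i⟩|z⟩|w⟩ ↦ |i⟩|z + x i mod 2⟩|w⟩`, acting on a vector
of amplitudes (the permutation of the basis is an involution). -/
def queryOracle {n d : ℕ} (x : Fin n → Bool) (ψ : Fin n × Bool × Fin d → ℂ) :
    Fin n × Bool × Fin d → ℂ :=
  fun b => ψ (b.1, xor b.2.1 (x b.1), b.2.2)

namespace QueryAlgorithm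

/-- The state of the algorithm on the input `x` after `t` queries and the unitary `U t`. -/
noncomputable def state {n : ℕ} (A : QueryAlgorithm n) (x : Fin n → Bool) :
    ℕ → Fin n × Bool × Fin A.work → ℂ
  | 0 => Matrix.mulVec (A.U 0).1 (Pi.single A.start 1)
  | t + 1 => Matrix.mulVec (A.U (t + 1)).1 (queryOracle x (A.state x t))

/-- The probability that the algorithm returns the bit `v` on the input `x`. -/
noncomputable def outputProb {n : ℕ} (A : QueryAlgorithm n) (x : Fin n → Bool) (v : Bool) : ℝ :=
  ∑ b, if A.output b = v then ‖A.state x A.queries b‖ ^ 2 else 0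

/-- The algorithm computes, with probability at least `2 / 3` on each input of the domain `D`,
the Boolean function `f` on `D` (the values of `f` outside `D` are irrelevant). -/
def Computes {n : ℕ} (A : QueryAlgorithm n) (D : Set (Fin n → Bool))
    (f : (Fin n → Bool) → Bool) : Prop :=
  ∀ x ∈ D, 2 / 3 ≤ A.outputProb x (f x)

end QueryAlgorithm

/-- The quantum query complexity `Q(f)` of the Boolean function `f` with domain `D`: the smallest
number of queries of a quantum query algorithm that computes `f` on `D`. -/
noncomputable def quantumQueryComplexity {n : ℕ} (D : Set (Fin n → Bool))
    (f : (Fin n → Bool) → Bool) : ℕ :=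
  sInf {T : ℕ | ∃ A : QueryAlgorithm n, A.queries = T ∧ A.Computes D f}

/-- The language of Dyck words in which the number of opening
parentheses (`DyckStep.U`) that are not closed yet never exceeds `k`. -/
def boundedDyckLanguage (k : ℕ) : Language DyckStep :=
  {w : List DyckStep | (∃ p : DyckWord, p.toList = w) ∧
    ∀ i : ℕ, (w.take i).count DyckStep.U ≤ (w.take i).count DyckStep.D + k}

/-- The word described by `n` bits: `0` stands for an opening and `1` for a closing parenthesis. -/
def parenWord {n : ℕ} (x : Fin n → Bool) : List DyckStep :=
  List.ofFn fun i => if x i then DyckStep.D else DyckStep.U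

open Classical in
/-- The query problem of recognizing Dyck words of length `n` and depth at most `k`. -/
noncomputable def dyckProblem (k n : ℕ) (x : Fin n → Bool) : Bool :=
  decide (parenWord x ∈ boundedDyckLanguage k)

/-! Encode a bit by nested majorities. A level-`l` block consists of `2m+1` blocks of level `l-1`,
exactly `m+1` of which encode its bit, with single parentheses at level `0`. A block has length
`(2m+1)^l` and balance `±1`, and its heights are only linear in `l`. Because the majority is won by
a single vote, turning over one winning sub-block turns over the whole block, so at least `(m+1)^l`
single-bit flips lead to a block encoding the opposite bit (`IsBlock.le_flipCount`).

Enclosed between `H` opening and `H+1` closing parentheses and padded by `()`, such a block gives a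
Dyck word of depth `O(l)` if it encodes an opening parenthesis, and an unbalanced word otherwise.
The adversary bound for Hamming distance `1` (`QueryAlgorithm.Computes.le_queries`) then forces
order `(m+1)^l` queries. The word has length at most `(24(m+1))^l`, so a large fixed `m` brings the
exponent above `1-ε`, while `l` of order `log n` keeps the depth logarithmic. -/

/-! ### Adversary bound for inputs at Hamming distance one. -/

/-- The input that differs from `x` exactly in the bit `i`. -/
def flipBit {n : ℕ} (x : Fin n → Bool) (i : Fin n) : Fin n → Bool :=
  Function.update x i (!x i)

theorem flipBit_flipBit {n : ℕ} (x : Fin n → Bool) (i : Fin n) :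
    flipBit (flipBit x i) i = x := by
  simp [flipBit]

theorem flipBit_of_ne {n : ℕ} (x : Fin n → Bool) {i j : Fin n} (h : j ≠ i) :
    flipBit x i j = x j := by
  simp [flipBit, h]

/-- The permutation of the basis that the oracle of the input `x` applies. -/
def oraclePerm {n d : ℕ} (x : Fin n → Bool) : Equiv.Perm (Fin n × Bool × Fin d) where
  toFun b := (b.1, xor b.2.1 (x b.1), b.2.2)
  invFun b := (b.1, xor b.2.1 (x b.1), b.2.2)
  left_inv b := by simp
  right_inv b := by simp

theorem queryOracle_apply {n d : ℕ} (x : Fin n → Bool) (ψ : Fin n × Bool × Fin d → ℂ)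
    (b : Fin n × Bool × Fin d) : queryOracle x ψ b = ψ (oraclePerm x b) := rfl

theorem oraclePerm_flipBit_of_ne {n d : ℕ} (x : Fin n → Bool) {i : Fin n}
    {b : Fin n × Bool × Fin d} (h : b.1 ≠ i) : oraclePerm (flipBit x i) b = oraclePerm x b := by
  simp [oraclePerm, flipBit_of_ne x h]

/-- The squared Euclidean norm of a vector of amplitudes. -/
noncomputable def normSqSum {β : Type*} [Fintype β] (ψ : β → ℂ) : ℝ := ∑ b, ‖ψ b‖ ^ 2

theorem normSqSum_mulVec {β : Type*} [Fintype β] [DecidableEq β] (U : Matrix.unitaryGroup β ℂ)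
    (ψ : β → ℂ) : normSqSum (Matrix.mulVec U.1 ψ) = normSqSum ψ := by
  have key : ∀ φ : β → ℂ, ((normSqSum φ : ℝ) : ℂ) = star φ ⬝ᵥ φ := by
    intro φ
    simp only [normSqSum, dotProduct, Pi.star_apply, Complex.ofReal_sum]
    refine Finset.sum_congr rfl fun b _ => ?_
    rw [RCLike.star_def, Complex.conj_mul']
    push_cast
    rfl
  have hU : star U.1 * U.1 = 1 := Matrix.mem_unitaryGroup_iff'.1 U.2
  apply Complex.ofReal_injective
  rw [key, key, Matrix.star_mulVec, Matrix.dotProduct_mulVec, Matrix.vecMul_vecMul,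
    ← Matrix.star_eq_conjTranspose, hU, Matrix.vecMul_one]

theorem normSqSum_queryOracle {n d : ℕ} (x : Fin n → Bool) (ψ : Fin n × Bool × Fin d → ℂ) :
    normSqSum (queryOracle x ψ) = normSqSum ψ :=
  Equiv.sum_comp (oraclePerm x) fun b => ‖ψ b‖ ^ 2

/-- The probability that the index register of the state `ψ` holds `i`. -/
noncomputable def queryMass {n d : ℕ} (i : Fin n) (ψ : Fin n × Bool × Fin d → ℂ) : ℝ :=
  ∑ b, if b.1 = i then ‖ψ b‖ ^ 2 else 0

theorem sum_queryMass {n d : ℕ} (ψ : Fin n × Bool × Fin d → ℂ) :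
    ∑ i, queryMass i ψ = normSqSum ψ := by
  unfold queryMass normSqSum
  rw [Finset.sum_comm]
  simp

theorem queryMass_nonneg {n d : ℕ} (i : Fin n) (ψ : Fin n × Bool × Fin d → ℂ) :
    0 ≤ queryMass i ψ :=
  Finset.sum_nonneg fun b _ => by split_ifs <;> positivity

theorem queryMass_queryOracle {n d : ℕ} (x : Fin n → Bool) (i : Fin n)
    (ψ : Fin n × Bool × Fin d → ℂ) : queryMass i (queryOracle x ψ) = queryMass i ψ :=
  Equiv.sum_comp (oraclePerm x) fun b => if b.1 = i then ‖ψ b‖ ^ 2 else 0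

theorem norm_sub_sq_le {a b : ℂ} : ‖a - b‖ ^ 2 ≤ 2 * ‖a‖ ^ 2 + 2 * ‖b‖ ^ 2 := by
  have h := norm_sub_le a b
  nlinarith [norm_nonneg (a - b), sq_nonneg (‖a‖ - ‖b‖)]

/-- One query to two inputs that differ in the bit `i` drives the states apart only by the parts
that query the bit `i`. -/
theorem normSqSum_queryOracle_sub_le {n d : ℕ} (x : Fin n → Bool) (i : Fin n)
    (φ ψ : Fin n × Bool × Fin d → ℂ) :
    normSqSum (queryOracle x φ - queryOracle (flipBit x i) ψ) ≤
      normSqSum (φ - ψ) + (2 * queryMass i φ + 2 * queryMass i ψ) := by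
  rw [← normSqSum_queryOracle x (φ - ψ), ← queryMass_queryOracle x i φ,
    ← queryMass_queryOracle (flipBit x i) i ψ]
  simp only [normSqSum, queryMass, Finset.mul_sum, ← Finset.sum_add_distrib]
  refine Finset.sum_le_sum fun b _ => ?_
  -- Away from index `i` both oracles permute the basis in the same way, so the difference is only
  -- rearranged there.
  by_cases h : b.1 = i
  · simp only [h, if_true, Pi.sub_apply]
    exact norm_sub_sq_le.trans (le_add_of_nonneg_left (by positivity))
  · simp [h, queryOracle_apply, oraclePerm_flipBit_of_ne x h]

namespace QueryAlgorithm

variable {n : ℕ} (A : QueryAlgorithm n)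

theorem normSqSum_state (x : Fin n → Bool) (t : ℕ) : normSqSum (A.state x t) = 1 := by
  induction t with
  | zero =>
    rw [state, normSqSum_mulVec, normSqSum, Finset.sum_eq_single A.start]
    · simp
    · intro b _ hb
      simp [hb]
    · simp
  | succ t ih => rw [state, normSqSum_mulVec, normSqSum_queryOracle, ih]

theorem normSqSum_state_succ_sub_le (x : Fin n → Bool) (i : Fin n) (t : ℕ) :
    normSqSum (A.state x (t + 1) - A.state (flipBit x i) (t + 1)) ≤
      normSqSum (A.state x t - A.state (flipBit x i) t) +
        (2 * queryMass i (A.state x t) + 2 * queryMass i (A.state (flipBit x i) t)) := by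
  rw [state, state, ← Matrix.mulVec_sub, normSqSum_mulVec]
  exact normSqSum_queryOracle_sub_le x i _ _

theorem outputProb_add_outputProb_not (x : Fin n → Bool) (v : Bool) :
    A.outputProb x v + A.outputProb x (!v) = 1 := by
  rw [← A.normSqSum_state x A.queries, outputProb, outputProb, ← Finset.sum_add_distrib]
  refine Finset.sum_congr rfl fun b _ => ?_
  cases v <;> cases A.output b <;> simp

/-- Per basis state, `|p|² - |q|² ≤ d(|p| + |q|) ≤ 6d² + (|p|² + |q|²)/12` with `d = |p - q|`. A gap
of `1/3` between output probabilities then forces squared distance at least `1/36`. -/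
theorem outputProb_sub_le (x y : Fin n → Bool) (v : Bool) :
    A.outputProb x v - A.outputProb y v ≤
      6 * normSqSum (A.state x A.queries - A.state y A.queries) + 1 / 6 := by
  have hx := A.normSqSum_state x A.queries
  have hy := A.normSqSum_state y A.queries
  have : 6 * normSqSum (A.state x A.queries - A.state y A.queries) + 1 / 6 =
      6 * normSqSum (A.state x A.queries - A.state y A.queries) +
        (1 / 12 * normSqSum (A.state x A.queries) +
          1 / 12 * normSqSum (A.state y A.queries)) := by
    rw [hx, hy]; norm_num
  rw [this]
  simp only [outputProb, normSqSum, Finset.mul_sum, ← Finset.sum_add_distrib,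
    ← Finset.sum_sub_distrib]
  refine Finset.sum_le_sum fun b _ => ?_
  split_ifs
  · rw [Pi.sub_apply]
    set p := A.state x A.queries b
    set q := A.state y A.queries b
    have h : ‖p‖ - ‖q‖ ≤ ‖p - q‖ := norm_sub_norm_le p q
    have h1 : ‖p‖ ^ 2 - ‖q‖ ^ 2 ≤ ‖p - q‖ * (‖p‖ + ‖q‖) := by
      nlinarith [norm_nonneg p, norm_nonneg q]
    nlinarith [sq_nonneg (12 * ‖p - q‖ - (‖p‖ + ‖q‖)), sq_nonneg (‖p‖ - ‖q‖)]
  · rw [sub_zero]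
    positivity

theorem Computes.normSqSum_sub_ge {A : QueryAlgorithm n} {D : Set (Fin n → Bool)}
    {f : (Fin n → Bool) → Bool}
    (hA : A.Computes D f) {x y : Fin n → Bool} (hx : x ∈ D) (hy : y ∈ D) (hxy : f y ≠ f x) :
    1 / 36 ≤ normSqSum (A.state x A.queries - A.state y A.queries) := by
  have h1 := hA x hx
  have h2 := hA y hy
  rw [Bool.eq_not.2 hxy] at h2
  have h3 := A.outputProb_add_outputProb_not y (f x)
  have h4 := A.outputProb_sub_le x y (f x)
  linarith

/-- The adversary bound for inputs at Hamming distance `1`: if each input in `Z` has at least `a`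
sensitive bits whose flip stays in `Z`, then at least `a / 144` queries are needed. -/
theorem Computes.le_queries {A : QueryAlgorithm n} {f : (Fin n → Bool) → Bool}
    {Z : Finset (Fin n → Bool)} (hA : A.Computes (Z : Set (Fin n → Bool)) f) (hZ : Z.Nonempty)
    {a : ℕ} (ha : ∀ x ∈ Z,
      a ≤ (Finset.univ.filter fun i => flipBit x i ∈ Z ∧ f (flipBit x i) ≠ f x).card) :
    a ≤ 144 * A.queries := by
  classical
  let R : Finset ((Fin n → Bool) × Fin n) := (Z ×ˢ Finset.univ).filter fun p =>
    flipBit p.1 p.2 ∈ Z ∧ f (flipBit p.1 p.2) ≠ f p.1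
  have mem_R : ∀ p, p ∈ R ↔ p.1 ∈ Z ∧ flipBit p.1 p.2 ∈ Z ∧ f (flipBit p.1 p.2) ≠ f p.1 := by
    simp [R]
  have card_R : a * Z.card ≤ R.card := by
    rw [Finset.card_filter, Finset.sum_product, mul_comm, ← smul_eq_mul]
    refine Finset.card_nsmul_le_sum _ _ _ fun x hx => ?_
    rw [← Finset.card_filter]
    exact ha x hx
  have flip_R : ∀ p ∈ R, (flipBit p.1 p.2, p.2) ∈ R := by
    intro p hp
    rw [mem_R] at hp ⊢
    simp only [flipBit_flipBit]
    exact ⟨hp.2.1, hp.1, hp.2.2.symm⟩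
  have mass_le : ∀ t, ∑ p ∈ R, queryMass p.2 (A.state p.1 t) ≤ Z.card := by
    intro t
    calc ∑ p ∈ R, queryMass p.2 (A.state p.1 t)
        ≤ ∑ p ∈ Z ×ˢ Finset.univ, queryMass p.2 (A.state p.1 t) :=
          Finset.sum_le_sum_of_subset_of_nonneg (Finset.filter_subset _ _)
            fun _ _ _ => queryMass_nonneg _ _
      _ = Z.card := by simp [Finset.sum_product, sum_queryMass, normSqSum_state]
  -- Flipping is an involution of `R`, so both endpoints of the pairs carry the same total mass and
  -- a query adds at most `4 * Z.card` to the progress.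
  have mass_flip : ∀ t, ∑ p ∈ R, queryMass p.2 (A.state (flipBit p.1 p.2) t) =
      ∑ p ∈ R, queryMass p.2 (A.state p.1 t) := by
    intro t
    refine Finset.sum_nbij' (fun p => (flipBit p.1 p.2, p.2)) (fun p => (flipBit p.1 p.2, p.2))
      flip_R flip_R ?_ ?_ ?_ <;> simp [flipBit_flipBit]
  have progress : ∀ t, ∑ p ∈ R, normSqSum (A.state p.1 t - A.state (flipBit p.1 p.2) t) ≤
      4 * Z.card * t := by
    intro t
    induction t with
    | zero => simp [state, normSqSum]
    | succ t ih =>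
      refine (Finset.sum_le_sum fun p _ => A.normSqSum_state_succ_sub_le p.1 p.2 t).trans ?_
      rw [Finset.sum_add_distrib, Finset.sum_add_distrib, ← Finset.mul_sum, ← Finset.mul_sum,
        mass_flip]
      have := mass_le t
      push_cast
      linarith
  have final : (R.card : ℝ) * (1 / 36) ≤
      ∑ p ∈ R, normSqSum (A.state p.1 A.queries - A.state (flipBit p.1 p.2) A.queries) := by
    rw [← nsmul_eq_mul]
    refine Finset.card_nsmul_le_sum _ _ _ fun p hp => ?_
    rw [mem_R] at hp
    exact hA.normSqSum_sub_ge hp.1 hp.2.1 hp.2.2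
  have hpos : (0 : ℝ) < Z.card := by exact_mod_cast hZ.card_pos
  have h1 : (a : ℝ) * Z.card ≤ R.card := by exact_mod_cast card_R
  have h2 := final.trans (progress A.queries)
  have h3 : (a : ℝ) ≤ 144 * A.queries := by
    refine le_of_mul_le_mul_right ?_ hpos
    linarith
  exact_mod_cast h3

end QueryAlgorithm

/-! ### An algorithm that reads the whole input. -/

/-- The basis permutation that exchanges the answer of the oracle with the bit of the stored word
to which the index register points, and moves on to the next index. -/
def readStep (n : ℕ) [NeZero n] : Equiv.Perm (Fin n × Bool × (Fin n → Bool)) where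
  toFun s := (s.1 + 1, s.2.2 s.1, Function.update s.2.2 s.1 s.2.1)
  invFun s := (s.1 - 1, s.2.2 (s.1 - 1), Function.update s.2.2 (s.1 - 1) s.2.1)
  left_inv s := by simp
  right_inv s := by simp

theorem permMatrix_mem_unitaryGroup {β : Type*} [Fintype β] [DecidableEq β] (σ : Equiv.Perm β) :
    σ.permMatrix ℂ ∈ Matrix.unitaryGroup β ℂ := by
  rw [Matrix.mem_unitaryGroup_iff, Matrix.star_eq_conjTranspose, Matrix.conjTranspose_permMatrix,
    ← Matrix.permMatrix_mul]
  simp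

theorem permMatrix_inv_mulVec_queryOracle_single {n d : ℕ} (x : Fin n → Bool)
    (σ : Equiv.Perm (Fin n × Bool × Fin d)) (s : Fin n × Bool × Fin d) :
    Matrix.mulVec (Equiv.Perm.permMatrix ℂ σ⁻¹) (queryOracle x (Pi.single s 1)) =
      Pi.single (σ (oraclePerm x s)) 1 := by
  rw [Matrix.permMatrix_mulVec]
  funext b
  rw [Function.comp_apply, queryOracle_apply, Pi.single_apply, Pi.single_apply]
  congr 1
  rw [eq_iff_iff, ← Equiv.eq_symm_apply, Equiv.Perm.inv_eq_iff_eq]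
  rfl

theorem QueryAlgorithm.outputProb_of_state_eq_single {n : ℕ} {A : QueryAlgorithm n}
    {x : Fin n → Bool} {s : Fin n × Bool × Fin A.work}
    (h : A.state x A.queries = Pi.single s 1) : A.outputProb x (A.output s) = 1 := by
  rw [QueryAlgorithm.outputProb, h, Finset.sum_eq_single s]
  · simp
  · intro b _ hb
    simp [hb]
  · simp

/-- The basis states whose work-space stores a word of `n` bits. -/
noncomputable def wordStateEquiv (n : ℕ) :
    Fin n × Bool × (Fin n → Bool) ≃ Fin n × Bool × Fin (Fintype.card (Fin n → Bool)) :=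
  (Equiv.refl _).prodCongr ((Equiv.refl _).prodCongr (Fintype.equivFin _))

/-- The algorithm that reads the input bit by bit into the work-space and then evaluates `f`. -/
noncomputable def readAlgorithm {n : ℕ} [NeZero n] (f : (Fin n → Bool) → Bool) :
    QueryAlgorithm n where
  queries := n
  work := Fintype.card (Fin n → Bool)
  start := wordStateEquiv n (0, false, fun _ => false)
  U t := if t = 0 then 1 else
    ⟨Equiv.Perm.permMatrix ℂ ((wordStateEquiv n).permCongr (readStep n))⁻¹,
      permMatrix_mem_unitaryGroup _⟩
  output b := f ((wordStateEquiv n).symm b).2.2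

theorem readAlgorithm_state {n : ℕ} [NeZero n] (f : (Fin n → Bool) → Bool) (x : Fin n → Bool)
    {t : ℕ} (ht : t ≤ n) :
    (readAlgorithm f).state x t = Pi.single (wordStateEquiv n (Fin.ofNat n t, false,
      fun j : Fin n => if (j : ℕ) < t then x j else false)) 1 := by
  induction t with
  | zero =>
    simp only [Nat.not_lt_zero, if_false]
    exact Matrix.one_mulVec _
  | succ t ih =>
    have htn : t < n := ht
    have hval : (Fin.ofNat n t : ℕ) = t := by simp [Nat.mod_eq_of_lt htn]
    rw [QueryAlgorithm.state, ih htn.le]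
    refine (permMatrix_inv_mulVec_queryOracle_single x
      ((wordStateEquiv n).permCongr (readStep n)) _).trans ?_
    have ho : ∀ s, oraclePerm x (wordStateEquiv n s) =
      wordStateEquiv n (s.1, xor s.2.1 (x s.1), s.2.2) := fun _ => rfl
    rw [ho, Equiv.permCongr_apply, Equiv.symm_apply_apply]
    congr 2
    refine Prod.ext ?_ (Prod.ext ?_ ?_)
    · simp [readStep, Fin.ext_iff, Fin.val_add]
    · simp [readStep, Nat.mod_eq_of_lt htn]
    -- Slot `t` still holds `false`, so the swap stores `x t` there and resets the answer register
    -- for the next query.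
    · funext j
      simp only [readStep, Equiv.coe_fn_mk, Function.update_apply, Fin.ext_iff, hval]
      by_cases h : (j : ℕ) = t
      · have hj : Fin.ofNat n t = j := Fin.ext (hval.trans h.symm)
        rw [if_pos h, if_pos (by omega), Bool.false_xor, hj]
      · have : (j : ℕ) < t + 1 ↔ (j : ℕ) < t := by omega
        simp [h, this]

theorem readAlgorithm_computes {n : ℕ} [NeZero n] (f : (Fin n → Bool) → Bool)
    (D : Set (Fin n → Bool)) : (readAlgorithm f).Computes D f := by
  intro x _
  have h := QueryAlgorithm.outputProb_of_state_eq_single (readAlgorithm_state f x le_rfl)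
  have hx : (readAlgorithm f).output (wordStateEquiv n (Fin.ofNat n n, false,
      fun j : Fin n => if (j : ℕ) < n then x j else false)) = f x := by
    simp [readAlgorithm]
  rw [← hx]
  exact (by norm_num : (2 / 3 : ℝ) ≤ 1).trans h.ge

/-- Since `sInf ∅ = 0`, a lower bound on the complexity needs some algorithm to exist; reading all
bits provides one. -/
theorem exists_computes_queries_eq {n : ℕ} (hn : n ≠ 0) (D : Set (Fin n → Bool))
    (f : (Fin n → Bool) → Bool) :
    ∃ A : QueryAlgorithm n, A.queries = quantumQueryComplexity D f ∧ A.Computes D f := by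
  have : NeZero n := ⟨hn⟩
  exact Nat.sInf_mem (s := {T : ℕ | ∃ A : QueryAlgorithm n, A.queries = T ∧ A.Computes D f})
    ⟨n, readAlgorithm f, rfl, readAlgorithm_computes f D⟩

/-! ### Balance and prefix heights of words. -/

/-- The number of opening (`false`) minus the number of closing (`true`) parentheses. -/
def balance (w : List Bool) : ℤ := w.count false - w.count true

theorem balance_append (u v : List Bool) : balance (u ++ v) = balance u + balance v := by
  simp only [balance, List.count_append]
  push_cast
  ring

/-- The balance of every prefix of `w` lies between `lo` and `hi`. -/
def PrefixesWithin (lo hi : ℤ) (w : List Bool) : Prop :=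
  ∀ i, lo ≤ balance (w.take i) ∧ balance (w.take i) ≤ hi

theorem PrefixesWithin.mono {lo hi lo' hi' : ℤ} {w : List Bool} (h : PrefixesWithin lo hi w)
    (hlo : lo' ≤ lo) (hhi : hi ≤ hi') : PrefixesWithin lo' hi' w :=
  fun i => ⟨hlo.trans (h i).1, (h i).2.trans hhi⟩

theorem PrefixesWithin.append {lo hi : ℤ} {u v : List Bool} (hu : PrefixesWithin lo hi u)
    (hv : PrefixesWithin (lo - balance u) (hi - balance u) v) : PrefixesWithin lo hi (u ++ v) := by
  intro i
  rw [List.take_append]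
  rcases le_total i u.length with h | h
  · rw [Nat.sub_eq_zero_of_le h, List.take_zero, List.append_nil]
    exact hu i
  · rw [List.take_of_length_le h, balance_append]
    have := hv (i - u.length)
    omega

theorem prefixesWithin_nil {lo hi : ℤ} (hlo : lo ≤ 0) (hhi : 0 ≤ hi) :
    PrefixesWithin lo hi [] := by
  intro i
  simp [balance, hlo, hhi]

theorem balance_replicate_false (k : ℕ) : balance (List.replicate k false) = k := by
  simp [balance, List.count_replicate]

theorem balance_replicate_true (k : ℕ) : balance (List.replicate k true) = -k := by
  simp [balance, List.count_replicate]

theorem prefixesWithin_replicate_false (k : ℕ) :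
    PrefixesWithin 0 k (List.replicate k false) := by
  intro i
  rw [List.take_replicate, balance_replicate_false]
  omega

theorem prefixesWithin_replicate_true (k : ℕ) :
    PrefixesWithin (-k) 0 (List.replicate k true) := by
  intro i
  rw [List.take_replicate, balance_replicate_true]
  omega

/-- The word `()()⋯()` with `p` pairs of parentheses. -/
def pairsWord : ℕ → List Bool
  | 0 => []
  | p + 1 => [false, true] ++ pairsWord p

theorem length_pairsWord (p : ℕ) : (pairsWord p).length = 2 * p := by
  induction p with
  | zero => rfl
  | succ p ih => rw [pairsWord, List.length_append, ih, List.length_cons, List.length_singleton]; ring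

theorem balance_pairsWord (p : ℕ) : balance (pairsWord p) = 0 := by
  induction p with
  | zero => rfl
  | succ p ih => rw [pairsWord, balance_append, ih]; rfl

theorem prefixesWithin_pairsWord (p : ℕ) : PrefixesWithin 0 1 (pairsWord p) := by
  induction p with
  | zero => exact prefixesWithin_nil le_rfl zero_le_one
  | succ p ih =>
    refine PrefixesWithin.append ?_ ih
    rintro (_ | _ | i) <;> simp [balance]

/-! ### Nested majority blocks. -/

/-- `IsBlock m l b w`: the word `w` of parentheses encodes the bit `b` at level `l`. At level `0` it
is the parenthesis `b`; at level `l + 1` it is a sequence of `2 * m + 1` words of level `l`,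
of which `m + 1` encode `b`. -/
def IsBlock (m : ℕ) : ℕ → Bool → List Bool → Prop
  | 0, b, w => w = [b]
  | l + 1, b, w => ∃ vs ws, List.Forall₂ (IsBlock m l) vs ws ∧ w = ws.flatten ∧
      vs.count b = m + 1 ∧ vs.count (!b) = m

theorem exists_isBlock (m l : ℕ) (b : Bool) : ∃ w, IsBlock m l b w := by
  induction l generalizing b with
  | zero => exact ⟨_, rfl⟩
  | succ l ih =>
    choose g hg using ih
    let vs := List.replicate (m + 1) b ++ List.replicate m (!b)
    refine ⟨_, vs, vs.map g, ?_, rfl, ?_, ?_⟩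
    · rw [List.forall₂_map_right_iff, List.forall₂_same]
      exact fun v _ => hg v
    · simp [vs, List.count_replicate]
    · simp [vs, List.count_replicate]

theorem IsBlock.length_eq {m l : ℕ} {b : Bool} {w : List Bool} (h : IsBlock m l b w) :
    w.length = (2 * m + 1) ^ l := by
  induction l generalizing b w with
  | zero => cases h; rfl
  | succ l ih =>
    obtain ⟨vs, ws, hvw, rfl, h1, h2⟩ := h
    have key : ∀ {vs ws}, List.Forall₂ (IsBlock m l) vs ws →
        ws.flatten.length = vs.length * (2 * m + 1) ^ l := by
      intro vs ws h
      induction h with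
      | nil => simp
      | cons h _ ih' => rw [List.flatten_cons, List.length_append, ih', ih h, List.length_cons]; ring
    rw [key hvw, ← List.count_add_count_not vs b, h1, h2]
    ring

theorem IsBlock.balance_eq {m l : ℕ} {b : Bool} {w : List Bool} (h : IsBlock m l b w) :
    balance w = balance [b] := by
  induction l generalizing b w with
  | zero => cases h; rfl
  | succ l ih =>
    obtain ⟨vs, ws, hvw, rfl, h1, h2⟩ := h
    have key : ∀ {vs ws}, List.Forall₂ (IsBlock m l) vs ws → balance ws.flatten = balance vs := by
      intro vs ws h
      induction h with
      | nil => rfl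
      | @cons v _ vs _ h _ ih' =>
        rw [List.flatten_cons, balance_append, ih', ih h, ← balance_append, List.singleton_append]
    rw [key hvw]
    cases b <;> simp only [Bool.not_true, Bool.not_false] at h2 <;> simp [balance, h1, h2]

/-- A prefix consists of whole sub-blocks, each moving the height by one, and part of one further
sub-block; thus each level adds at most `2m+1`. -/
theorem IsBlock.prefixesWithin {m l : ℕ} {b : Bool} {w : List Bool} (h : IsBlock m l b w) :
    PrefixesWithin (-((2 * m + 1) * l + 1 : ℕ)) ((2 * m + 1) * l + 1 : ℕ) w := by
  induction l generalizing b w with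
  | zero =>
    cases h
    rintro (_ | i) <;> cases b <;> simp [balance]
  | succ l ih =>
    obtain ⟨vs, ws, hvw, rfl, h1, h2⟩ := h
    have key : ∀ {vs ws}, List.Forall₂ (IsBlock m l) vs ws →
        PrefixesWithin (-(vs.length + ((2 * m + 1) * l + 1) : ℕ))
          (vs.length + ((2 * m + 1) * l + 1) : ℕ) ws.flatten := by
      intro vs ws h
      induction h with
      | nil => exact prefixesWithin_nil (by omega) (by omega)
      | @cons v _ vs _ h _ ih' =>
        rw [List.flatten_cons, List.length_cons]
        refine ((ih h).mono (by omega) (by omega)).append (ih'.mono ?_ ?_) <;>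
          rw [h.balance_eq] <;> cases v <;> simp [balance] <;> omega
    refine (key hvw).mono ?_ ?_ <;> rw [← List.count_add_count_not vs b, h1, h2] <;>
      push_cast <;> linarith

/-! ### Sensitivity of blocks. -/

open Classical in
/-- The number of positions of `w` at which replacing the bit leads to a word that satisfies `P`. -/
noncomputable def flipCount : (List Bool → Prop) → List Bool → ℕ
  | _, [] => 0
  | P, a :: w => (if P ((!a) :: w) then 1 else 0) + flipCount (fun u => P (a :: u)) w

/-- Lets sensitive positions be counted separately in each sub-block. -/
theorem flipCount_append (P : List Bool → Prop) (u v : List Bool) :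
    flipCount P (u ++ v) =
      flipCount (fun s => P (s ++ v)) u + flipCount (fun s => P (u ++ s)) v := by
  induction u generalizing P with
  | nil => simp [flipCount]
  | cons a u ih => simp only [List.cons_append, flipCount, ih, add_assoc]

theorem flipCount_mono {P Q : List Bool → Prop} (h : ∀ w, P w → Q w) (w : List Bool) :
    flipCount P w ≤ flipCount Q w := by
  induction w generalizing P Q with
  | nil => rfl
  | cons a w ih =>
    refine add_le_add ?_ (ih fun u hu => h _ hu)
    split_ifs with h1 h2
    · rfl
    · exact absurd (h _ h1) h2
    · exact Nat.zero_le _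
    · rfl

open Classical in
theorem flipCount_ofFn {n : ℕ} (P : List Bool → Prop) (x : Fin n → Bool) :
    flipCount P (List.ofFn x) =
      (Finset.univ.filter fun i => P (List.ofFn (flipBit x i))).card := by
  induction n generalizing P with
  | zero => simp [flipCount]
  | succ n ih =>
    rw [List.ofFn_succ, flipCount, ih, Finset.card_filter, Finset.card_filter, Fin.sum_univ_succ]
    have h0 : List.ofFn (flipBit x 0) = (!x 0) :: List.ofFn fun i => x i.succ := by
      rw [List.ofFn_succ]
      simp [flipBit]
    have hs : ∀ i : Fin n, List.ofFn (flipBit x i.succ) =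
        x 0 :: List.ofFn (flipBit (fun i => x i.succ) i) := by
      intro i
      rw [List.ofFn_succ, flipBit_of_ne x (Fin.succ_ne_zero i).symm]
      congr 2
      funext j
      simp [flipBit, Function.update_apply]
    simp only [h0, hs]

/-- Each of the `m+1` sub-blocks encoding `b` contributes `(m+1)^l` flips. Turning one over leaves
`m` votes for `b` and `m+1` for `!b`, which is exactly a block for `!b`. -/
theorem IsBlock.le_flipCount {m l : ℕ} {b : Bool} {w : List Bool} (h : IsBlock m l b w) :
    (m + 1) ^ l ≤ flipCount (IsBlock m l (!b)) w := by
  induction l generalizing b w with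
  | zero => cases h; simp [flipCount, IsBlock]
  | succ l ih =>
    obtain ⟨vs, ws, hvw, rfl, h1, h2⟩ := h
    -- A general `P` allows the sub-blocks already passed to be absorbed into the predicate.
    have key : ∀ {vs ws}, List.Forall₂ (IsBlock m l) vs ws → ∀ P : List Bool → Prop,
        (∀ vs' ws', List.Forall₂ (IsBlock m l) vs' ws' → vs'.count b + 1 = vs.count b →
          vs'.count (!b) = vs.count (!b) + 1 → P ws'.flatten) →
        vs.count b * (m + 1) ^ l ≤ flipCount P ws.flatten := by
      intro vs ws hvw
      induction hvw with
      | nil => simp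
      | @cons v w vs ws h hvw ih' =>
        intro P hP
        rw [List.flatten_cons, flipCount_append, List.count_cons, add_mul]
        have htail := ih' (fun u => P (w ++ u)) fun vs' ws' h' h3 h4 =>
          hP (v :: vs') (w :: ws') (.cons h h') (by simp only [List.count_cons]; omega)
            (by simp only [List.count_cons]; omega)
        rw [add_comm (flipCount _ w)]
        refine add_le_add htail ?_
        rcases eq_or_ne v b with rfl | hv
        · rw [beq_self_eq_true, if_pos rfl, one_mul]
          refine (ih h).trans (flipCount_mono (fun u hu => ?_) w)
          exact hP ((!v) :: vs) (u :: ws) (.cons hu hvw) (by simp) (by simp)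
        · simp [hv]
    have := key hvw (IsBlock m (l + 1) (!b)) fun vs' ws' h' h3 h4 =>
      ⟨vs', ws', h', rfl, by omega, by rw [Bool.not_not]; omega⟩
    rwa [h1, ← pow_succ'] at this

/-! ### Embedding blocks into the Dyck problem. -/

theorem parenWord_eq_map {n : ℕ} (x : Fin n → Bool) :
    parenWord x = (List.ofFn x).map fun b => if b then DyckStep.D else DyckStep.U := by
  rw [parenWord, List.map_ofFn]
  rfl

theorem count_map_dyckStep (w : List Bool) :
    (w.map fun b => if b then DyckStep.D else DyckStep.U).count DyckStep.U = w.count false ∧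
      (w.map fun b => if b then DyckStep.D else DyckStep.U).count DyckStep.D = w.count true := by
  induction w with
  | nil => simp
  | cons b w ih => cases b <;> simp [ih.1, ih.2]

theorem parenWord_mem_boundedDyckLanguage_iff {k n : ℕ} {x : Fin n → Bool} :
    parenWord x ∈ boundedDyckLanguage k ↔
      balance (List.ofFn x) = 0 ∧ PrefixesWithin 0 k (List.ofFn x) := by
  rw [parenWord_eq_map]
  set w := List.ofFn x
  have hU := fun v => (count_map_dyckStep v).1
  have hD := fun v => (count_map_dyckStep v).2
  constructor
  · rintro ⟨⟨p, hp⟩, h⟩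
    have h1 := p.count_U_eq_count_D
    have h2 := p.count_D_le_count_U
    rw [hp, hU, hD] at h1
    refine ⟨by simp [balance, h1], fun i => ?_⟩
    have h2 := h2 i
    have h := h i
    rw [hp] at h2
    rw [← List.map_take, hU, hD] at h h2
    simp only [balance]
    omega
  · rintro ⟨h0, h⟩
    refine ⟨⟨⟨_, ?_, fun i => ?_⟩, rfl⟩, fun i => ?_⟩
    · rw [hU, hD]
      simp only [balance] at h0
      omega
    all_goals
      rw [← List.map_take, hU, hD]
      have := h i
      simp only [balance] at this
      omega

/-- The word `w` between `H` opening and `H + 1` closing parentheses, followed by `p` pairs `()`. -/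
def encloseWord (H p : ℕ) (w : List Bool) : List Bool :=
  List.replicate H false ++ (w ++ (List.replicate (H + 1) true ++ pairsWord p))

theorem balance_encloseWord (H p : ℕ) (w : List Bool) :
    balance (encloseWord H p w) = balance w - 1 := by
  simp only [encloseWord, balance_append, balance_replicate_false, balance_replicate_true,
    balance_pairsWord]
  push_cast
  ring

theorem prefixesWithin_encloseWord {H p : ℕ} {w : List Bool} (hw : balance w = 1)
    (h : PrefixesWithin (-H) H w) : PrefixesWithin 0 (2 * H + 1 : ℕ) (encloseWord H p w) := by
  have h1 := prefixesWithin_replicate_false H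
  have h2 := prefixesWithin_replicate_true (H + 1)
  have h3 := prefixesWithin_pairsWord p
  refine (h1.mono ?_ ?_).append ((h.mono ?_ ?_).append ((h2.mono ?_ ?_).append (h3.mono ?_ ?_))) <;>
    push_cast [balance_replicate_false, balance_replicate_true, hw] <;> omega

/-- The total balance is that of the block minus one: `0` for an opening bit, `-2` for a closing
one. Only the first case needs the height bounds. -/
theorem dyckProblem_eq_not {m l p k n : ℕ} {b : Bool} {w : List Bool} {x : Fin n → Bool}
    (hw : IsBlock m l b w) (hk : 2 * ((2 * m + 1) * l + 1) + 1 ≤ k)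
    (hx : List.ofFn x = encloseWord ((2 * m + 1) * l + 1) p w) : dyckProblem k n x = !b := by
  classical
  rw [dyckProblem]
  have hbal := hw.balance_eq
  cases b
  · refine (decide_eq_true_iff).2 (parenWord_mem_boundedDyckLanguage_iff.2 ⟨?_, ?_⟩)
    · rw [hx, balance_encloseWord, hbal]
      rfl
    · rw [hx]
      exact (prefixesWithin_encloseWord hbal hw.prefixesWithin).mono le_rfl (by exact_mod_cast hk)
  · refine (decide_eq_false_iff_not).2 fun h => ?_
    have := (parenWord_mem_boundedDyckLanguage_iff.1 h).1
    rw [hx, balance_encloseWord, hbal] at this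
    exact absurd this (by decide)

theorem exists_ofFn_eq {w : List Bool} {n : ℕ} (h : w.length = n) :
    ∃ x : Fin n → Bool, List.ofFn x = w := by
  subst h
  exact ⟨w.get, List.ofFn_get w⟩

theorem pow_le_quantumQueryComplexity_dyckProblem {m l p k n : ℕ}
    (hk : 2 * ((2 * m + 1) * l + 1) + 1 ≤ k)
    (hn : (2 * m + 1) ^ l + (2 * ((2 * m + 1) * l + 1) + 1) + 2 * p = n) :
    (m + 1) ^ l ≤ 144 * quantumQueryComplexity Set.univ (dyckProblem k n) := by
  classical
  set H := (2 * m + 1) * l + 1 with hH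
  obtain ⟨A, hA, hAf⟩ := exists_computes_queries_eq (n := n) (by omega) Set.univ (dyckProblem k n)
  rw [← hA]
  let Z : Finset (Fin n → Bool) := Finset.univ.filter fun x =>
    ∃ b w, IsBlock m l b w ∧ List.ofFn x = encloseWord H p w
  have mem_Z : ∀ x, x ∈ Z ↔ ∃ b w, IsBlock m l b w ∧ List.ofFn x = encloseWord H p w := by
    simp [Z]
  refine QueryAlgorithm.Computes.le_queries (Z := Z) (fun x _ => hAf x trivial) ?_ fun x hx => ?_
  · obtain ⟨w, hw⟩ := exists_isBlock m l false
    obtain ⟨x, hx⟩ := exists_ofFn_eq (w := encloseWord H p w) (n := n) (by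
      simp only [encloseWord, List.length_append, List.length_replicate, hw.length_eq,
        length_pairsWord]
      omega)
    exact ⟨x, (mem_Z x).2 ⟨_, w, hw, hx⟩⟩
  · obtain ⟨b, w, hw, hxw⟩ := (mem_Z x).1 hx
    let P : List Bool → Prop := fun u => ∃ w', IsBlock m l (!b) w' ∧ u = encloseWord H p w'
    calc (m + 1) ^ l ≤ flipCount (IsBlock m l (!b)) w := hw.le_flipCount
      _ ≤ flipCount P (List.ofFn x) := by
        rw [hxw, encloseWord, flipCount_append, flipCount_append]
        refine le_trans (flipCount_mono (fun u hu => ?_) w)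
          ((Nat.le_add_right _ _).trans (Nat.le_add_left _ _))
        exact ⟨u, hu, rfl⟩
      _ ≤ _ := by
        rw [flipCount_ofFn]
        refine Finset.card_le_card fun i hi => ?_
        obtain ⟨w', hw', hi⟩ := (Finset.mem_filter.1 hi).2
        refine Finset.mem_filter.2 ⟨Finset.mem_univ _, (mem_Z _).2 ⟨_, w', hw', hi⟩, ?_⟩
        rw [dyckProblem_eq_not hw' hk hi, dyckProblem_eq_not hw hk hxw]
        simp

/-! ### Choice of parameters. -/

/-- Equivalent to `24 ≤ (24(m+1))^ε`, which holds for large `m`. The constant `24` is the loss per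
level in `block_length_add_le`. -/
theorem exists_rpow_one_sub_le {ε : ℝ} (hε : 0 < ε) :
    ∃ m : ℕ, (24 * (m + 1) : ℝ) ^ (1 - ε) ≤ m + 1 := by
  refine ⟨⌈(24 : ℝ) ^ ε⁻¹⌉₊, ?_⟩
  set m := ⌈(24 : ℝ) ^ ε⁻¹⌉₊
  have hm : (24 : ℝ) ^ ε⁻¹ ≤ 24 * (m + 1) := by
    have := Nat.le_ceil ((24 : ℝ) ^ ε⁻¹)
    have h0 : (0 : ℝ) ≤ m := Nat.cast_nonneg m
    linarith
  have h24 : (24 : ℝ) ≤ (24 * (m + 1)) ^ ε := by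
    calc (24 : ℝ) = ((24 : ℝ) ^ ε⁻¹) ^ ε := by
          rw [← Real.rpow_mul (by norm_num), inv_mul_cancel₀ hε.ne', Real.rpow_one]
      _ ≤ _ := Real.rpow_le_rpow (by positivity) hm hε.le
  rw [Real.rpow_sub (by positivity), Real.rpow_one, div_le_iff₀ (by positivity)]
  nlinarith [(Nat.cast_nonneg m : (0 : ℝ) ≤ m)]

theorem block_length_add_le (m : ℕ) {l : ℕ} (hl : l ≠ 0) :
    (2 * m + 1) ^ l + (2 * ((2 * m + 1) * l + 1) + 1) ≤ (24 * (m + 1)) ^ l := by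
  have h1 : 2 * m + 1 ≤ (2 * m + 1) ^ l := Nat.le_self_pow hl _
  have h2 : l + 1 ≤ 2 ^ l := Nat.lt_two_pow_self
  have h3 : (2 * m + 1) * (l + 1) ≤ (2 * m + 1) ^ l * 2 ^ l := Nat.mul_le_mul h1 h2
  have h4 : (2 * m + 1) ^ l ≤ (2 * m + 1) ^ l * 2 ^ l := Nat.le_mul_of_pos_right _ (by positivity)
  have h5 : 6 ≤ 6 ^ l := Nat.le_self_pow hl _
  calc _ ≤ 6 * ((2 * m + 1) ^ l * 2 ^ l) := by
        have : 1 ≤ (2 * m + 1) ^ l * 2 ^ l := Nat.one_le_iff_ne_zero.2 (by positivity)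
        nlinarith
    _ ≤ 6 ^ l * ((2 * m + 1) ^ l * 2 ^ l) := Nat.mul_le_mul_right _ h5
    _ = (6 * ((2 * m + 1) * 2)) ^ l := by rw [mul_pow, mul_pow]
    _ ≤ _ := Nat.pow_le_pow_left (by omega) l

theorem theorem2 (ε : ℝ) (hε : 0 < ε) :
    ∃ c : ℝ, 0 < c ∧ ∃ C : ℝ, 0 < C ∧ ∃ N : ℕ, ∀ n : ℕ, N ≤ n → Even n →
      C * (n : ℝ) ^ (1 - ε) ≤
        (quantumQueryComplexity Set.univ (dyckProblem ⌊c * Real.log n⌋₊ n) : ℝ) := by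
  obtain ⟨m, hm⟩ := exists_rpow_one_sub_le (lt_min hε one_pos)
  -- Capping at `1` keeps the exponent `1 - δ` nonnegative, so the power is monotone in its base.
  set δ := min ε 1 with hδ
  have hδ1 : 0 ≤ 1 - δ := sub_nonneg.2 (min_le_right _ _)
  -- The required depth is `(4m+2)l + 3 ≤ (4m+5)l`, and `l ≤ log n`. The threshold `24(m+1)` ensures
  -- `l ≥ 1`; the factor `1/(m+1)` in `C` pays for rounding `n` up to `(24(m+1))^(l+1)`.
  refine ⟨4 * m + 5, by positivity, 1 / (144 * (m + 1)), by positivity, 24 * (m + 1),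
    fun n hn hne => ?_⟩
  have hn0 : n ≠ 0 := by omega
  have hB : 1 < 24 * (m + 1) := by omega
  set l := Nat.log (24 * (m + 1)) n with hl
  have hl0 : l ≠ 0 := (Nat.log_pos hB hn).ne'
  have hle : (24 * (m + 1)) ^ l ≤ n := Nat.pow_log_le_self _ hn0
  have hlt : n < (24 * (m + 1)) ^ (l + 1) := Nat.lt_pow_succ_log_self hB n
  obtain ⟨p, hp⟩ : ∃ p, (2 * m + 1) ^ l + (2 * ((2 * m + 1) * l + 1) + 1) + 2 * p = n := by
    have h1 := (block_length_add_le m hl0).trans hle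
    have h2 : Even ((2 * m + 1) ^ l + (2 * ((2 * m + 1) * l + 1) + 1)) :=
      (Odd.pow (odd_two_mul_add_one m)).add_odd (odd_two_mul_add_one _)
    obtain ⟨p, hp⟩ := (Nat.even_sub h1).2 (iff_of_true hne h2)
    exact ⟨p, by omega⟩
  have hk : 2 * ((2 * m + 1) * l + 1) + 1 ≤ ⌊((4 * m + 5 : ℝ)) * Real.log n⌋₊ := by
    have hlog : (l : ℝ) ≤ Real.log n := by
      have h1 : (1 : ℝ) ≤ Real.log (24 * (m + 1) : ℕ) := by
        rw [Real.le_log_iff_exp_le (by positivity)]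
        have := Real.exp_one_lt_three
        have h0 : (0 : ℝ) ≤ m := Nat.cast_nonneg m
        push_cast
        linarith
      calc (l : ℝ) ≤ l * Real.log (24 * (m + 1) : ℕ) := le_mul_of_one_le_right (by positivity) h1
        _ = Real.log (((24 * (m + 1)) ^ l : ℕ) : ℝ) := by rw [Nat.cast_pow, Real.log_pow]
        _ ≤ Real.log n := Real.log_le_log (by positivity) (by exact_mod_cast hle)
    have h1 : (1 : ℝ) ≤ l := by exact_mod_cast Nat.one_le_iff_ne_zero.2 hl0
    refine Nat.le_floor ?_
    calc ((2 * ((2 * m + 1) * l + 1) + 1 : ℕ) : ℝ) ≤ (4 * m + 5) * l := by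
          push_cast
          linarith
      _ ≤ _ := mul_le_mul_of_nonneg_left hlog (by positivity)
  have hQ := pow_le_quantumQueryComplexity_dyckProblem hk hp
  have hQ' : ((m + 1 : ℝ)) ^ l ≤ 144 *
      (quantumQueryComplexity Set.univ (dyckProblem ⌊((4 * m + 5 : ℝ)) * Real.log n⌋₊ n) : ℝ) := by
    exact_mod_cast hQ
  have hpow : (n : ℝ) ^ (1 - ε) ≤ (m + 1) * (m + 1) ^ l := by
    calc (n : ℝ) ^ (1 - ε) ≤ (n : ℝ) ^ (1 - δ) :=
          Real.rpow_le_rpow_of_exponent_le (by exact_mod_cast Nat.one_le_iff_ne_zero.2 hn0)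
            (sub_le_sub_left (min_le_left _ _) _)
      _ ≤ ((24 * (m + 1) : ℝ) ^ (l + 1)) ^ (1 - δ) :=
          Real.rpow_le_rpow (by positivity) (by exact_mod_cast hlt.le) hδ1
      _ = ((24 * (m + 1) : ℝ) ^ (1 - δ)) ^ (l + 1) := by
          rw [← Real.rpow_natCast, ← Real.rpow_natCast, ← Real.rpow_mul (by positivity),
            ← Real.rpow_mul (by positivity),
            mul_comm (1 - δ)]
      _ ≤ (m + 1 : ℝ) ^ (l + 1) := pow_le_pow_left₀ (by positivity) hm _
      _ = _ := pow_succ' _ _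
  rw [one_div, inv_mul_le_iff₀ (by positivity)]
  calc (n : ℝ) ^ (1 - ε) ≤ (m + 1) * (m + 1) ^ l := hpow
    _ ≤ (m + 1) * (144 * _) := mul_le_mul_of_nonneg_left hQ' (by positivity)
    _ = _ := by ring
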